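/- Let $\mathbb F=\mathbb Q(q,t)$ with $q,t$ formal parameters, let $N\ge 1$, and let $\Lambda_N\subset\mathbb F[x_1,\dots,x_N]\subset\mathbb F(x_1,\dots,x_N)$ be the space of symmetric polynomials. All operators below are $\mathbb F$-linear operators on $\mathbb F(x_1,\dots,x_N)$. Let $\gamma_i$ be the inverse $q$-shift operator $$(\gamma_i f)(x_1,\dots,x_N)=f(x_1,\dots,q^{-1}x_i,\dots,x_N),$$ let $\Delta=\prod_{1\le i<j\le N}(x_i-x_j)$, and for another variable $u$ put $$D_N(u)=\Delta^{-1}\sum_{\sigma\in\mathfrak S_N}(-1)^\sigma\prod_{i=1}^N\bigl(x_i^{N-\sigma(i)}(1+u\,t^{\sigma(i)-1}\gamma_i)\bigr).$$ For $i\ne j$ let $$A_{ij}=\frac{x_i-t\,x_j}{x_i-x_j},\qquad B_{ij}=\frac{(t-1)\,x_j}{x_i-x_j}.$$ Put $U_i=(t-1)\bigl(\prod_{l\ne i}A_{il}\bigr)\gamma_i$ for $i=1,\dots,N$, and let $\mathcal Z=[Z_{ij}]_{i,j=1}^N$ be the matrix of operators with $$Z_{ii}=\Bigl(\prod_{l\ne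 i}A_{il}\Bigr)\gamma_i,\qquad Z_{ij}=B_{ij}\Bigl(\prod_{l\ne i,j}A_{jl}\Bigr)\gamma_j\quad(i\ne j).$$ Let $\mathcal U=(U_1,\dots,U_N)$ be the row vector of the $U_i$, and $\mathcal E$ the column vector of size $N$ with every entry $1$. Then $D_N(0)=1$, and every coefficient of $D_N(u)$ maps $\Lambda_N$ to itself, so that the ratio $D_N(ut)/D_N(u)=D_N(ut)\,D_N(u)^{-1}$ is defined as a formal power series in $u$ whose coefficients are operators on $\Lambda_N$. The action of this ratio on $\Lambda_N$ coincides with the action of $$1+u\,\mathcal U\,(1+u\,\mathcal Z)^{-1}\,\mathcal E .$$ Here $(1+u\mathcal Z)^{-1}$ is expanded as a formal power series in $u$ whose coefficients are $N\times N$ matrices of operators, and the claim is that for every $n\ge 0$ the coefficients of $u^n$ in the two series agree on every $f\in\Lambda_N$. -/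

import Mathlib

open scoped BigOperators

namespace Macdonald

noncomputable section

/-- The ground field `𝔽 = ℚ(q, t)`. -/
abbrev Ground : Type := FractionRing (MvPolynomial (Fin 2) ℚ)

/-- The formal parameter `q`. -/
def q : Ground := algebraMap (MvPolynomial (Fin 2) ℚ) Ground (MvPolynomial.X 0)

/-- The formal parameter `t`. -/
def t : Ground := algebraMap (MvPolynomial (Fin 2) ℚ) Ground (MvPolynomial.X 1)

theorem q_ne_zero : q ≠ 0 := by
  unfold q
  rw [Ne, FaithfulSMul.algebraMap_eq_zero_iff]
  exact MvPolynomial.X_ne_zero 0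

/-- The polynomial ring `𝔽[x₁, …, x_N]`. The variables are indexed by `Fin N`, so that `x_{i+1}`
of the usual numbering is `X i` here. -/
abbrev Pol (N : ℕ) : Type := MvPolynomial (Fin N) Ground

/-- The field of rational functions `𝔽(x₁, …, x_N)`. -/
abbrev RatFun (N : ℕ) : Type := FractionRing (Pol N)

/-- The `𝔽`-linear operators on `𝔽(x₁, …, x_N)`; multiplication is composition. -/
abbrev Op (N : ℕ) : Type := Module.End Ground (RatFun N)

/-- The variable `x_i` as a rational function. -/
def x {N : ℕ} (i : Fin N) : RatFun N := algebraMap (Pol N) (RatFun N) (MvPolynomial.X i)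

/-- The space `Λ_N` of symmetric polynomials, as a subspace of `𝔽(x₁, …, x_N)`. -/
def Lam (N : ℕ) : Submodule Ground (RatFun N) :=
  (MvPolynomial.symmetricSubalgebra (Fin N) Ground).toSubmodule.map
    (IsScalarTower.toAlgHom Ground (Pol N) (RatFun N)).toLinearMap

/-- The substitution `x_i ↦ c x_i` (the other variables are fixed) on polynomials. -/
def scaleHom {N : ℕ} (c : Ground) (i : Fin N) : Pol N →ₐ[Ground] Pol N :=
  MvPolynomial.aeval fun j =>
    if j = i then MvPolynomial.C c * MvPolynomial.X j else MvPolynomial.X j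

theorem scaleHom_comp {N : ℕ} (c d : Ground) (h : c * d = 1) (i : Fin N) :
    (scaleHom c i).comp (scaleHom d i) = AlgHom.id Ground (Pol N) := by
  apply MvPolynomial.algHom_ext
  intro j
  by_cases hj : j = i
  · subst hj
    simp only [scaleHom, AlgHom.comp_apply, MvPolynomial.aeval_X, if_true, map_mul,
      MvPolynomial.algHom_C, MvPolynomial.algebraMap_eq, AlgHom.id_apply]
    rw [← mul_assoc, ← MvPolynomial.C_mul, mul_comm d c, h, MvPolynomial.C_1, one_mul]
  · simp [scaleHom, hj]

/-- The automorphism `f(x₁, …, x_N) ↦ f(x₁, …, q⁻¹ x_i, …, x_N)` of the polynomial ring. -/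
def shiftPol {N : ℕ} (i : Fin N) : Pol N ≃ₐ[Ground] Pol N :=
  AlgEquiv.ofAlgHom (scaleHom q⁻¹ i) (scaleHom q i)
    (scaleHom_comp _ _ (inv_mul_cancel₀ q_ne_zero) i)
    (scaleHom_comp _ _ (mul_inv_cancel₀ q_ne_zero) i)

/-- The inverse `q`-shift operator `γ_i`:
`(γ_i f)(x₁, …, x_N) = f(x₁, …, q⁻¹ x_i, …, x_N)` for rational functions `f`. -/
def gam {N : ℕ} (i : Fin N) : Op N :=
  (IsFractionRing.algEquivOfAlgEquiv (K := RatFun N) (L := RatFun N) (shiftPol i)).toLinearMap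

/-- The operator of multiplication by a rational function. -/
def mulOp {N : ℕ} (g : RatFun N) : Op N := LinearMap.mulLeft Ground g

/-- The Vandermonde polynomial `Δ(x₁, …, x_N) = ∏_{i<j} (x_i - x_j)`. -/
def vand (N : ℕ) : RatFun N := ∏ i : Fin N, ∏ j ∈ Finset.Ioi i, (x i - x j)

/-- `D_N(u) = Δ⁻¹ · det [ x_i^{N-j} (1 + u t^{j-1} γ_i) ]`, the determinant being the alternating
sum over permutations `σ` of the products over `i = 1, …, N` (in this order) of
`x_i^{N-σ(i)} (1 + u t^{σ(i)-1} γ_i)`. It is regarded as a formal power series in `u` with operator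
coefficients. Since indices start from `0`, the exponents read `N - 1 - σ(i)` and `σ(i)`. -/
def D (N : ℕ) : PowerSeries (Op N) :=
  PowerSeries.C (mulOp (vand N)⁻¹) *
    ∑ σ : Equiv.Perm (Fin N), ((Equiv.Perm.sign σ : ℤˣ) : ℤ) •
      (List.ofFn fun i : Fin N =>
        PowerSeries.C (mulOp (x i ^ (N - 1 - (σ i : ℕ)))) *
          (1 + PowerSeries.X * PowerSeries.C (t ^ (σ i : ℕ) • gam i))).prod

/-- `A_{ij} = (x_i - t x_j) / (x_i - x_j)`. -/
def A {N : ℕ} (i j : Fin N) : RatFun N := (x i - t • x j) / (x i - x j)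

/-- `B_{ij} = (t - 1) x_j / (x_i - x_j)`. -/
def B {N : ℕ} (i j : Fin N) : RatFun N := ((t - 1) • x j) / (x i - x j)

/-- The operators `U_i = (t - 1) (∏_{l ≠ i} A_{il}) γ_i`. -/
def U {N : ℕ} (i : Fin N) : Op N :=
  (t - 1) • (mulOp (∏ l ∈ Finset.univ.erase i, A i l) * gam i)

/-- The matrix `𝒵` of operators: `Z_{ii} = (∏_{l ≠ i} A_{il}) γ_i`, and
`Z_{ij} = B_{ij} (∏_{l ≠ i, j} A_{jl}) γ_j` for `i ≠ j`. -/
def Z (N : ℕ) : Matrix (Fin N) (Fin N) (Op N) := Matrix.of fun i j =>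
  if i = j then mulOp (∏ l ∈ Finset.univ.erase i, A i l) * gam i
  else mulOp (B i j * ∏ l ∈ (Finset.univ.erase i).erase j, A j l) * gam j

/-- The row vector `𝒰` with the entries `U_i`. -/
def rowU (N : ℕ) : Matrix (Fin 1) (Fin N) (Op N) := Matrix.of fun _ i => U i

/-- The column vector `ℰ` with every entry `1`. -/
def colE (N : ℕ) : Matrix (Fin N) (Fin 1) (Op N) := Matrix.of fun _ _ => 1

/-- The (two-sided) inverse of a formal power series with constant coefficient `1` over a
possibly noncommutative ring. -/
def seriesInv {R : Type} [Ring R] (P : PowerSeries R) : PowerSeries R :=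
  PowerSeries.invOfUnit P 1

/-- The substitution `P(u) ↦ P(a u)` for a scalar `a ∈ 𝔽`. -/
def rescaleBy {R : Type} [Ring R] [Module Ground R] (a : Ground) (P : PowerSeries R) :
    PowerSeries R :=
  PowerSeries.mk fun n => a ^ n • PowerSeries.coeff n P

/-- The power series `𝒰 (1 + u 𝒵)⁻¹ ℰ` in `u` with operator coefficients; `(1 + u 𝒵)⁻¹` is the
inverse in the ring of power series in `u` over the `N × N` matrices of operators. -/
def resolvent (N : ℕ) : PowerSeries (Op N) :=
  PowerSeries.mk fun n =>
    (rowU N * PowerSeries.coeff n (seriesInv (1 + PowerSeries.X * PowerSeries.C (Z N))) *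
      colE N : Matrix (Fin 1) (Fin 1) (Op N)) 0 0

/-- All coefficients of the series map `Λ_N` to itself. -/
def Preserves {N : ℕ} (P : PowerSeries (Op N)) : Prop :=
  ∀ n : ℕ, ∀ f ∈ Lam N, PowerSeries.coeff n P f ∈ Lam N

/-- The restriction to `Λ_N` of a series whose coefficients map `Λ_N` to itself. -/
def restr {N : ℕ} (P : PowerSeries (Op N)) (h : Preserves P) :
    PowerSeries (Module.End Ground (Lam N)) :=
  PowerSeries.mk fun n => (PowerSeries.coeff n P).restrict (h n)

/-- The ratio `P(u t) / P(u) = P(u t) P(u)⁻¹` of series of operators on `Λ_N`, where `P` has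
constant coefficient `1`. -/
def ratio {N : ℕ} (P : PowerSeries (Module.End Ground (Lam N))) :
    PowerSeries (Module.End Ground (Lam N)) :=
  rescaleBy t P * seriesInv P

end

end Macdonald

/-!
The ratio is computed by exhibiting `h(u) = (1 + u 𝒵)⁻¹ ℰ D_N(u)` in closed form: its entry `h_i(u)`
is the operator `D_{N-1}(ut)` in the variables other than `x_i`. The two identities
`(1 + u 𝒵) h(u) = D_N(u) ℰ` and `u 𝒰 h(u) = D_N(ut) - D_N(u)` then give
`D_N(ut) = (1 + u 𝒰 (1 + u 𝒵)⁻¹ ℰ) D_N(u)`. This holds for operators on all rational functions;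
symmetric polynomials enter only through the fact that `D_N(u)` preserves them, so that the right
factor `D_N(u)` may be cancelled on `Λ_N`.

To verify the two identities, the determinant `D_N(u)` is expanded as
`∑_I u^k t^{k(k-1)/2} (∏_{a ∈ I, b ∉ I} A_{ab}) ∏_{i ∈ I} γ_i`, where `k = #I`: the summands with the
shifts in `I` form a Vandermonde determinant (`coeff_D`, `vand_inv_mul_detPol`). Comparing the
coefficients of `∏_{i ∈ I} γ_i` leaves rational identities in `A` and `B` (`sum_zCoeff`,
`sum_uCoeff`), all of which are cases of one partial fraction expansion
(`prod_div_add_sum_eq_one`), evaluated at `x_i` for `i ∈ I`, at `t x_i` for `i ∉ I`, and at `0`.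

The operator `D_N(u)` preserves symmetric polynomials because it sends them to quotients of an
alternating polynomial by the Vandermonde product (`preserves_D`).
-/

namespace Macdonald

open Finset

/-! ### Identities in a field, finite sums and series -/

/-- The partial fraction expansion in `y` of `∏ (y - s v_a) / (y - v_a)`. It is Lagrange
interpolation, at the nodes `v_a`, of the polynomial `∏ (y - v_a) - ∏ (y - s v_a)`, whose degree is
less than the number of nodes. The three identities for `A` and `B` below are its
specializations. -/
theorem prod_div_add_sum_eq_one {K ι : Type*} [Field K] [DecidableEq ι] (I : Finset ι) (v : ι → K)
    (hv : Set.InjOn v I) (s y : K) (hy : ∀ a ∈ I, y ≠ v a) :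
    ∏ a ∈ I, (y - s * v a) / (y - v a) +
      ∑ j ∈ I, (s - 1) * v j / (y - v j) * ∏ l ∈ I.erase j, (v j - s * v l) / (v j - v l) = 1 := by
  rcases I.eq_empty_or_nonempty with rfl | hI
  · simp
  -- The difference of two monic polynomials of degree `#I` is interpolated at the nodes `v`.
  have hmonic : ∀ w : ι → K, (Lagrange.nodal I w).Monic := fun w => Lagrange.nodal_monic
  have hdeg : (Lagrange.nodal I v - Lagrange.nodal I (fun a => s * v a)).degree < #I := by
    have h := Polynomial.degree_sub_lt_left
      (p := Lagrange.nodal I v) (q := Lagrange.nodal I (fun a => s * v a))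
      (by rw [Lagrange.degree_nodal, Lagrange.degree_nodal]) Lagrange.nodal_ne_zero
      (by rw [(hmonic v).leadingCoeff, (hmonic _).leadingCoeff])
    rwa [Lagrange.degree_nodal] at h
  have hint := Lagrange.eq_interpolate_of_eval_eq
    (fun j => -∏ a ∈ I, (v j - s * v a)) hv hdeg (fun j hj => by
      rw [Polynomial.eval_sub, Lagrange.eval_nodal_at_node hj, Lagrange.eval_nodal, zero_sub])
  have hev := congrArg (Polynomial.eval y) hint
  rw [Lagrange.eval_interpolate_not_at_node _ hy, Polynomial.eval_sub, Lagrange.eval_nodal,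
    Lagrange.eval_nodal] at hev
  have hne : ∏ a ∈ I, (y - v a) ≠ 0 := prod_ne_zero_iff.2 fun a ha => sub_ne_zero.2 (hy a ha)
  have hsum : ∑ j ∈ I, (s - 1) * v j / (y - v j) * ∏ l ∈ I.erase j, (v j - s * v l) / (v j - v l) =
      ∑ j ∈ I, Lagrange.nodalWeight I v j * (y - v j)⁻¹ * -∏ a ∈ I, (v j - s * v a) := by
    refine sum_congr rfl fun j hj => ?_
    rw [Lagrange.nodalWeight, ← mul_prod_erase I _ hj, prod_div_distrib, prod_inv_distrib]
    ring
  rw [hsum, prod_div_distrib]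
  rw [div_add' _ _ _ hne, div_eq_one_iff_eq hne]
  linear_combination -hev

theorem prod_pairs_insert {M ι : Type*} [CommMonoid M] [LinearOrder ι] (r : ι → ι → M)
    (hr : ∀ i j, r i j = r j i) (S : Finset ι) (a : ι) (ha : a ∉ S) :
    (∏ i ∈ insert a S, ∏ j ∈ insert a S, if i < j then r i j else 1) =
      (∏ i ∈ S, ∏ j ∈ S, if i < j then r i j else 1) * ∏ j ∈ S, r j a := by
  have hS : ∀ i ∈ S, (∏ j ∈ insert a S, if i < j then r i j else 1) =
      (if i < a then r i a else 1) * ∏ j ∈ S, if i < j then r i j else 1 :=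
    fun i _ => prod_insert ha
  rw [prod_insert ha, prod_insert ha, prod_congr rfl hS, prod_mul_distrib, if_neg (lt_irrefl a),
    one_mul, ← mul_assoc, ← prod_mul_distrib, mul_comm]
  congr 1
  refine prod_congr rfl fun j hj => ?_
  rcases lt_trichotomy a j with h | h | h
  · rw [if_pos h, if_neg h.not_gt, mul_one, hr]
  · exact absurd (h ▸ hj) ha
  · rw [if_neg h.not_gt, if_pos h, one_mul]

/-- A product over pairs `i < j` of a symmetric function which is `c` inside `I` and `1` outside `I`:
only the pairs that meet both `I` and its complement, and the number of pairs inside `I`, matter. -/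
theorem prod_pairs_eq {M : Type*} [CommMonoid M] {N : ℕ} (r : Fin N → Fin N → M)
    (hr : ∀ i j, r i j = r j i) (c : M) (I : Finset (Fin N))
    (hI : ∀ i ∈ I, ∀ j ∈ I, i ≠ j → r i j = c) (hI' : ∀ i ∉ I, ∀ j ∉ I, i ≠ j → r i j = 1) :
    ∏ i, ∏ j ∈ Ioi i, r i j = c ^ (#I).choose 2 * ∏ i ∈ I, ∏ j ∈ Iᶜ, r i j := by
  have h1 : ∀ S ⊆ I, (∏ i ∈ S, ∏ j ∈ S, if i < j then r i j else 1) = c ^ (#S).choose 2 := by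
    intro S
    induction S using Finset.induction_on with
    | empty => simp
    | insert a S ha ih =>
      intro hS
      rw [insert_subset_iff] at hS
      rw [prod_pairs_insert r hr S a ha, ih hS.2, card_insert_of_notMem ha,
        prod_congr rfl (fun j hj => hI j (hS.2 hj) a hS.1 (fun h => ha (h ▸ hj))), prod_const,
        ← pow_add, Nat.choose_succ_succ' _ 1, Nat.choose_one_right, add_comm]
  have h2 : ∀ S ⊆ Iᶜ, (∏ i ∈ S ∪ I, ∏ j ∈ S ∪ I, if i < j then r i j else 1) =
      c ^ (#I).choose 2 * ∏ i ∈ I, ∏ j ∈ S, r i j := by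
    intro S
    induction S using Finset.induction_on with
    | empty => intro _; simp [h1 I subset_rfl]
    | insert a S ha ih =>
      intro hS
      rw [insert_subset_iff, mem_compl] at hS
      have hd : Disjoint S I := (subset_compl_iff_disjoint_right).1 hS.2
      rw [insert_union, prod_pairs_insert r hr _ a (by simp [ha, hS.1]), ih hS.2, prod_union hd,
        prod_congr rfl (fun j hj => hI' j (mem_compl.1 (hS.2 hj)) a hS.1 (fun h => ha (h ▸ hj))),
        prod_const_one, one_mul, mul_assoc, ← prod_mul_distrib]
      congr 1
      exact prod_congr rfl fun i _ => by rw [prod_insert ha, mul_comm]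
  have h3 := h2 Iᶜ subset_rfl
  rw [union_comm, union_compl] at h3
  rw [← h3]
  refine prod_congr rfl fun i _ => ?_
  rw [← prod_filter, filter_lt_eq_Ioi]

/-- Pairs `j ∉ I` with `#I = n` correspond to pairs `j ∈ I` with `#I = n + 1`. -/
theorem sum_powersetCard_erase {M ι : Type*} [AddCommMonoid M] [Fintype ι] [DecidableEq ι] (n : ℕ)
    (F : ι → Finset ι → M) :
    ∑ j, ∑ I ∈ powersetCard n (univ.erase j), F j I =
      ∑ I ∈ powersetCard (n + 1) univ, ∑ j ∈ I, F j (I.erase j) := by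
  rw [sum_sigma', sum_sigma']
  refine sum_bij' (fun p _ => ⟨insert p.1 p.2, p.1⟩) (fun p _ => ⟨p.2, p.1.erase p.2⟩) ?_ ?_ ?_ ?_ ?_
  · rintro ⟨j, I⟩ h
    simp only [mem_sigma, mem_univ, true_and, mem_powersetCard, subset_erase, subset_univ] at h
    simp [mem_powersetCard, card_insert_of_notMem h.1, h.2]
  · rintro ⟨I, j⟩ h
    simp only [mem_sigma, true_and, mem_powersetCard, subset_univ] at h
    simp [mem_powersetCard, subset_erase, card_erase_of_mem h.2, h.1]
  · rintro ⟨j, I⟩ h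
    simp only [mem_sigma, mem_univ, true_and, mem_powersetCard, subset_erase, subset_univ] at h
    simp [erase_insert h.1]
  · rintro ⟨I, j⟩ h
    simp only [mem_sigma, true_and, mem_powersetCard, subset_univ] at h
    simp [insert_erase h.2]
  · rintro ⟨j, I⟩ h
    simp only [mem_sigma, mem_univ, true_and, mem_powersetCard, subset_erase, subset_univ] at h
    simp [erase_insert h.1]

theorem mul_seriesInv {R : Type} [Ring R] (P : PowerSeries R)
    (h : PowerSeries.constantCoeff P = 1) : P * seriesInv P = 1 :=
  PowerSeries.mul_invOfUnit P 1 (h.trans Units.val_one.symm)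

/-- If the vectors `h n` are the coefficients of a solution of `(1 + u Z) h(u) = d(u) ℰ`, then
`h(u) = (1 + u Z)⁻¹ ℰ d(u)`. -/
theorem sum_inv_mulVec_eq {R : Type} [Ring R] {ι : Type} [Fintype ι] [DecidableEq ι]
    (Z : Matrix ι ι R) (h : ℕ → ι → R) (d : ℕ → R) (h0 : ∀ i, h 0 i = d 0)
    (hs : ∀ n i, h (n + 1) i + ∑ j, Z i j * h n j = d (n + 1)) (n : ℕ) :
    ∑ p ∈ antidiagonal n,
      (PowerSeries.coeff p.1 (seriesInv (1 + PowerSeries.X * PowerSeries.C Z))).mulVec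
        (fun _ => d p.2) = h n := by
  set V := seriesInv (1 + PowerSeries.X * PowerSeries.C Z) with hV
  have hmul : (1 + PowerSeries.X * PowerSeries.C Z) * V = 1 :=
    mul_seriesInv _ (by simp)
  have hV0 : PowerSeries.coeff 0 V = 1 := by
    simpa [add_mul, mul_assoc] using congrArg (PowerSeries.coeff 0) hmul
  have hVs : ∀ n, PowerSeries.coeff (n + 1) V = -(Z * PowerSeries.coeff n V) := by
    intro n
    have := congrArg (PowerSeries.coeff (n + 1)) hmul
    rw [add_mul, one_mul, mul_assoc, map_add, PowerSeries.coeff_succ_X_mul,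
      PowerSeries.coeff_C_mul, PowerSeries.coeff_one, if_neg n.succ_ne_zero] at this
    exact eq_neg_of_add_eq_zero_left this
  induction n with
  | zero =>
    funext i
    simp [hV0, h0]
  | succ n ih =>
    rw [Finset.Nat.antidiagonal_succ, sum_cons, sum_map]
    simp only [Function.Embedding.prodMap, Function.Embedding.coeFn_mk, Prod.map_fst, Prod.map_snd,
      Function.Embedding.refl_apply, Nat.succ_eq_add_one, hVs, hV0, Matrix.one_mulVec,
      Matrix.neg_mulVec, sum_neg_distrib, ← Matrix.mulVec_mulVec]
    rw [← Matrix.mulVec_sum, ih]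
    funext i
    simp only [Pi.add_apply, Pi.neg_apply, ← hs n i, Matrix.mulVec, dotProduct]
    abel

theorem sum_antidiagonal_assoc {M : Type*} [AddCommMonoid M] (n : ℕ) (F : ℕ → ℕ → ℕ → M) :
    ∑ p ∈ antidiagonal n, ∑ r ∈ antidiagonal p.1, F r.1 r.2 p.2 =
      ∑ p ∈ antidiagonal n, ∑ r ∈ antidiagonal p.2, F p.1 r.1 r.2 := by
  rw [sum_sigma', sum_sigma']
  refine sum_nbij' (fun s => ⟨(s.2.1, s.2.2 + s.1.2), (s.2.2, s.1.2)⟩)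
    (fun s => ⟨(s.1.1 + s.2.1, s.2.2), (s.1.1, s.2.1)⟩) ?_ ?_ ?_ ?_ ?_
  all_goals
    rintro ⟨⟨a, b⟩, ⟨c, d⟩⟩ h
    simp only [mem_sigma, HasAntidiagonal.mem_antidiagonal] at h
    obtain ⟨rfl, rfl⟩ := h
    simp [add_assoc]

/-- If series `P`, `P'` of operators on a subspace are the restrictions of `S` and of `R S`, then
`P' P⁻¹` is the restriction of `R`; no invariance of the subspace under `R` is needed. -/
theorem coe_coeff_mul_apply {K V : Type*} [CommRing K] [AddCommGroup V] [Module K V]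
    {W : Submodule K V} (S R : PowerSeries (Module.End K V))
    (P P' Q : PowerSeries (Module.End K W))
    (hP : ∀ n w, (PowerSeries.coeff n P w : V) = PowerSeries.coeff n S (w : V))
    (hP' : ∀ n w, (PowerSeries.coeff n P' w : V) = PowerSeries.coeff n (R * S) (w : V))
    (hQ : P * Q = 1) (n : ℕ) (w : W) :
    (PowerSeries.coeff n (P' * Q) w : V) = PowerSeries.coeff n R (w : V) := by
  have hinv : ∀ b, ∑ r ∈ antidiagonal b,
      PowerSeries.coeff r.1 S (PowerSeries.coeff r.2 Q w : V) = if b = 0 then (w : V) else 0 := by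
    intro b
    have h : PowerSeries.coeff b (P * Q) w =
        (PowerSeries.coeff b (1 : PowerSeries (Module.End K W))) w := by rw [hQ]
    rw [PowerSeries.coeff_mul, LinearMap.sum_apply] at h
    have h' := congrArg (Subtype.val) h
    rw [Submodule.coe_sum] at h'
    simp only [Module.End.mul_apply, hP] at h'
    rw [h', PowerSeries.coeff_one]
    split_ifs <;> rfl
  rw [PowerSeries.coeff_mul, LinearMap.sum_apply, Submodule.coe_sum]
  simp only [Module.End.mul_apply, hP', PowerSeries.coeff_mul, LinearMap.sum_apply]
  rw [sum_antidiagonal_assoc n fun a b c =>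
    PowerSeries.coeff a R (PowerSeries.coeff b S (PowerSeries.coeff c Q w : V))]
  simp only [← map_sum, hinv]
  rw [sum_eq_single (n, 0)]
  · rw [if_pos rfl]
  · rintro ⟨a, b⟩ h hne
    rw [HasAntidiagonal.mem_antidiagonal] at h
    have hb : b ≠ 0 := by
      rintro rfl
      exact hne (by rw [← h, add_zero])
    rw [if_neg hb, map_zero]
  · intro h
    exact absurd (HasAntidiagonal.mem_antidiagonal.2 (add_zero n)) h

/-! ### Shift and multiplication operators -/

noncomputable section

variable {N : ℕ}

theorem algHom_ext_x {f g : RatFun N →ₐ[Ground] RatFun N} (h : ∀ i, f (x i) = g (x i)) :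
    f = g := by
  have hp : f.comp (IsScalarTower.toAlgHom Ground (Pol N) (RatFun N)) =
      g.comp (IsScalarTower.toAlgHom Ground (Pol N) (RatFun N)) :=
    MvPolynomial.algHom_ext fun i => h i
  have hp' : ∀ p : Pol N, f (algebraMap (Pol N) (RatFun N) p) = g (algebraMap _ _ p) :=
    fun p => DFunLike.congr_fun hp p
  refine AlgHom.ext fun z => ?_
  obtain ⟨a, b, -, rfl⟩ := IsFractionRing.div_surjective (Pol N) z
  rw [map_div₀, map_div₀, hp', hp']

/-- The inverse `q`-shift `γ_i` as an algebra homomorphism. -/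
def shift (i : Fin N) : RatFun N →ₐ[Ground] RatFun N :=
  (IsFractionRing.algEquivOfAlgEquiv (K := RatFun N) (L := RatFun N) (shiftPol i)).toAlgHom

theorem shift_x (i j : Fin N) :
    shift i (x j) = if j = i then algebraMap Ground (RatFun N) q⁻¹ * x j else x j := by
  change IsFractionRing.algEquivOfAlgEquiv (shiftPol i) (x j) = _
  rw [x, IsFractionRing.algEquivOfAlgEquiv_algebraMap]
  change algebraMap (Pol N) (RatFun N) (scaleHom q⁻¹ i (MvPolynomial.X j)) = _
  rw [scaleHom, MvPolynomial.aeval_X]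
  split_ifs
  · rw [map_mul]; rfl
  · rfl

theorem shift_commute (i j : Fin N) : Commute (shift i) (shift j) := by
  apply algHom_ext_x
  intro k
  have h : ∀ i, shift i (x k) = algebraMap Ground _ (if k = i then q⁻¹ else 1) * x k := by
    intro i
    rw [shift_x]
    split_ifs
    · rfl
    · rw [map_one, one_mul]
  simp only [AlgHom.mul_apply, h, map_mul, AlgHom.commutes]
  exact mul_left_comm _ _ _

/-- The product of the commuting shifts `γ_i` over `i ∈ I`. -/
def shifts (I : Finset (Fin N)) : RatFun N →ₐ[Ground] RatFun N :=
  I.noncommProd shift fun i _ j _ _ => shift_commute i j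

theorem shifts_empty : shifts (∅ : Finset (Fin N)) = 1 := rfl

theorem shifts_insert {i : Fin N} {I : Finset (Fin N)} (hi : i ∉ I) :
    shifts (insert i I) = shift i * shifts I :=
  noncommProd_insert_of_notMem _ _ _ _ hi

theorem shifts_x (I : Finset (Fin N)) (j : Fin N) :
    shifts I (x j) = if j ∈ I then algebraMap Ground (RatFun N) q⁻¹ * x j else x j := by
  induction I using Finset.induction_on with
  | empty => simp [shifts_empty]
  | insert i I hi ih =>
    rw [shifts_insert hi, AlgHom.mul_apply, ih]
    by_cases hji : j = i
    · subst hji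
      simp [hi, shift_x]
    · by_cases hj : j ∈ I <;> simp [hj, hji, shift_x, AlgHom.commutes]

/-- The substitution `x_j ↦ q⁻¹ x_j` for all `j ∈ I`, on polynomials; `shifts I` extends it. -/
def scalePol (I : Finset (Fin N)) : Pol N →ₐ[Ground] Pol N :=
  MvPolynomial.aeval fun j =>
    if j ∈ I then MvPolynomial.C q⁻¹ * MvPolynomial.X j else MvPolynomial.X j

theorem shifts_algebraMap (I : Finset (Fin N)) (p : Pol N) :
    shifts I (algebraMap (Pol N) (RatFun N) p) = algebraMap _ _ (scalePol I p) := by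
  have h : (shifts I).comp (IsScalarTower.toAlgHom Ground (Pol N) (RatFun N)) =
      (IsScalarTower.toAlgHom Ground (Pol N) (RatFun N)).comp (scalePol I) := by
    refine MvPolynomial.algHom_ext fun j => ?_
    change shifts I (x j) = algebraMap (Pol N) (RatFun N) (scalePol I (MvPolynomial.X j))
    rw [shifts_x, scalePol, MvPolynomial.aeval_X]
    split_ifs
    · rw [map_mul]; rfl
    · rfl
  exact DFunLike.congr_fun h p

theorem gam_eq (i : Fin N) : gam i = (shift i).toLinearMap := rfl

theorem toLinearMap_mul' (f g : RatFun N →ₐ[Ground] RatFun N) :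
    (f * g).toLinearMap = (f.toLinearMap * g.toLinearMap : Op N) := rfl

theorem mulOp_mul (f g : RatFun N) : mulOp (f * g) = mulOp f * mulOp g :=
  LinearMap.ext fun z => mul_assoc f g z

theorem mulOp_one : mulOp (1 : RatFun N) = 1 :=
  LinearMap.ext fun z => one_mul z

theorem mulOp_add (f g : RatFun N) : mulOp (f + g) = mulOp f + mulOp g :=
  LinearMap.ext fun z => add_mul f g z

theorem mulOp_sum {ι : Type*} (s : Finset ι) (f : ι → RatFun N) :
    mulOp (∑ i ∈ s, f i) = ∑ i ∈ s, mulOp (f i) := by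
  refine LinearMap.ext fun z => ?_
  rw [LinearMap.sum_apply]
  exact Finset.sum_mul _ _ _

theorem toLinearMap_mul_mulOp (f : RatFun N →ₐ[Ground] RatFun N) (g : RatFun N) :
    f.toLinearMap * mulOp g = mulOp (f g) * f.toLinearMap :=
  LinearMap.ext fun z => map_mul f g z

/-- The scalar `t` as a rational function. -/
def tau : RatFun N := algebraMap Ground (RatFun N) t

theorem smul_eq_mulOp (c : Ground) (P : Op N) :
    c • P = mulOp (algebraMap Ground (RatFun N) c) * P :=
  LinearMap.ext fun z => Algebra.smul_def c (P z)

theorem A_eq (i j : Fin N) : A i j = (x i - tau * x j) / (x i - x j) := by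
  rw [A, Algebra.smul_def]; rfl

theorem B_eq (i j : Fin N) : B i j = ((tau - 1) * x j) / (x i - x j) := by
  rw [B, Algebra.smul_def, map_sub, map_one]; rfl

theorem shift_x_of_ne {i j : Fin N} (h : j ≠ i) : shift i (x j) = x j := by
  rw [shift_x, if_neg h]

theorem map_tau (f : RatFun N →ₐ[Ground] RatFun N) : f tau = tau := f.commutes t

theorem shift_A {i a b : Fin N} (ha : a ≠ i) (hb : b ≠ i) : shift i (A a b) = A a b := by
  rw [A_eq, map_div₀, map_sub, map_sub, map_mul, map_tau, shift_x_of_ne ha, shift_x_of_ne hb]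

theorem x_injective : Function.Injective (x : Fin N → RatFun N) :=
  (IsFractionRing.injective (Pol N) (RatFun N)).comp (MvPolynomial.X_injective)

theorem x_ne_zero (i : Fin N) : x i ≠ 0 := by
  rw [x, Ne, FaithfulSMul.algebraMap_eq_zero_iff]
  exact MvPolynomial.X_ne_zero i

theorem tau_mul_x_ne {i j : Fin N} (h : i ≠ j) : tau * x i ≠ x j := by
  intro he
  have h1 : tau * x i = algebraMap (Pol N) (RatFun N) (MvPolynomial.C t * MvPolynomial.X i) := by
    rw [map_mul]; rfl
  rw [h1, x] at he
  have h2 := congrArg (MvPolynomial.coeff (Finsupp.single j 1))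
    (IsFractionRing.injective (Pol N) (RatFun N) he)
  rw [MvPolynomial.coeff_C_mul, MvPolynomial.coeff_X, MvPolynomial.coeff_X] at h2
  rw [if_neg (fun hs => h (Finsupp.single_left_injective one_ne_zero hs)), if_pos rfl] at h2
  simp at h2

/-! ### The linear system for the operators in one variable less -/

theorem x_sub_ne_zero {i j : Fin N} (h : i ≠ j) : x i - x j ≠ 0 :=
  sub_ne_zero.2 (x_injective.ne h)

/-- The product of `A_{ab}` over `a ∈ I`, `b ∈ J`. -/
def prodA (I J : Finset (Fin N)) : RatFun N := ∏ a ∈ I, ∏ b ∈ J, A a b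

theorem prodA_eq_mul_erase {I J : Finset (Fin N)} {j : Fin N} (hj : j ∈ I) :
    prodA I J = (∏ b ∈ J, A j b) * prodA (I.erase j) J :=
  (mul_prod_erase I _ hj).symm

theorem prodA_eq_mul_erase_right {I J : Finset (Fin N)} {i : Fin N} (hi : i ∈ J) :
    prodA I J = (∏ a ∈ I, A a i) * prodA I (J.erase i) := by
  rw [prodA, prodA, ← prod_mul_distrib]
  exact prod_congr rfl fun a _ => (mul_prod_erase J _ hi).symm

theorem shift_prodA {I J : Finset (Fin N)} {i : Fin N} (hI : i ∉ I) (hJ : i ∉ J) :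
    shift i (prodA I J) = prodA I J := by
  simp only [prodA, map_prod]
  exact prod_congr rfl fun a ha => prod_congr rfl fun b hb =>
    shift_A (fun h => hI (h ▸ ha)) (fun h => hJ (h ▸ hb))

/-- The partial fraction identity at the nodes `x_a`, with ratio `t`. It is used for `y = x_i`,
`y = t x_i` and `y = 0`. -/
theorem prod_A_div_add_sum (I : Finset (Fin N)) (y : RatFun N) (hy : ∀ a ∈ I, y ≠ x a) :
    ∏ a ∈ I, (y - tau * x a) / (y - x a) +
      ∑ j ∈ I, (tau - 1) * x j / (y - x j) * ∏ l ∈ I.erase j, A j l = 1 := by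
  simp only [A_eq]
  exact prod_div_add_sum_eq_one I x x_injective.injOn tau y hy

/-- The case `y = 0`, that is, `∑_j ∏_{l ≠ j} A_{jl} = (t^k - 1) / (t - 1)`. -/
theorem sum_prod_A (I : Finset (Fin N)) :
    (tau - 1) * ∑ j ∈ I, ∏ l ∈ I.erase j, A j l = tau ^ #I - 1 := by
  have h := prod_A_div_add_sum I 0 fun a _ => (x_ne_zero a).symm
  have h1 : ∀ a ∈ I, (0 - tau * x a) / (0 - x a) = (tau : RatFun N) := fun a _ => by
    have := x_ne_zero a
    field_simp
    ring
  have h2 : ∀ j ∈ I, (tau - 1) * x j / (0 - x j) * ∏ l ∈ I.erase j, A j l =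
      -((tau - 1) * ∏ l ∈ I.erase j, A j l) := fun j _ => by
    have := x_ne_zero j
    rw [zero_sub, div_neg, mul_div_cancel_right₀ _ this, neg_mul]
  rw [prod_congr rfl h1, prod_const, sum_congr rfl h2, sum_neg_distrib, ← mul_sum] at h
  linear_combination -h

/-- The case `y = x_i`. -/
theorem prod_A_add_sum_B (I : Finset (Fin N)) (i : Fin N) (hi : i ∉ I) :
    ∏ l ∈ I, A i l + ∑ j ∈ I, B i j * ∏ l ∈ I.erase j, A j l = 1 := by
  have h := prod_A_div_add_sum I (x i) fun a ha hx => hi (x_injective hx ▸ ha)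
  simpa only [← A_eq, ← B_eq] using h

/-- The case `y = t x_i`, multiplied by `∏ A_{ai}`; the poles at `x_i = x_a / t` of the factors
`1 / A_{ai}` are those of the partial fraction expansion. -/
theorem pow_add_sum_B (I : Finset (Fin N)) (i : Fin N) (hi : i ∉ I) :
    tau ^ #I + ∑ j ∈ I, B i j * (∏ l ∈ I.erase j, A j l) * ∏ a ∈ I.erase j, A a i =
      ∏ a ∈ I, A a i := by
  have hne : ∀ a ∈ I, i ≠ a := fun a ha h => hi (h ▸ ha)
  have h := prod_A_div_add_sum I (tau * x i) fun a ha => tau_mul_x_ne (hne a ha)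
  have h' := congrArg ((∏ a ∈ I, A a i) * ·) h
  simp only [mul_one, mul_add, mul_sum] at h'
  rw [← h']
  congr 1
  · rw [← prod_mul_distrib, ← prod_const]
    refine prod_congr rfl fun a ha => ?_
    have h1 := x_sub_ne_zero (hne a ha).symm
    have h2 := sub_ne_zero.2 (tau_mul_x_ne (hne a ha))
    rw [A_eq]
    field_simp
    ring
  · refine sum_congr rfl fun j hj => ?_
    have h1 := x_sub_ne_zero (hne j hj).symm
    have h1' := x_sub_ne_zero (hne j hj)
    have h2 := sub_ne_zero.2 (tau_mul_x_ne (hne j hj))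
    have h3 : B i j = A j i * ((tau - 1) * x j / (tau * x i - x j)) := by
      rw [A_eq, B_eq]
      field_simp
      ring
    rw [h3, ← mul_prod_erase I _ hj]
    ring

/-- The rational function `g` for which `Z_{ij} = g γ_j`. -/
def zCoeff (i j : Fin N) : RatFun N :=
  if i = j then ∏ l ∈ univ.erase j, A j l else B i j * ∏ l ∈ (univ.erase i).erase j, A j l

theorem Z_apply (i j : Fin N) : Z N i j = mulOp (zCoeff i j) * gam j := by
  rw [Z, Matrix.of_apply, zCoeff]
  split_ifs with h
  · rw [h]
  · rfl

theorem prod_erase_univ_A {I : Finset (Fin N)} {j : Fin N} (hj : j ∈ I) :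
    ∏ l ∈ univ.erase j, A j l = (∏ l ∈ I.erase j, A j l) * ∏ b ∈ Iᶜ, A j b := by
  rw [← prod_union (disjoint_compl_right.mono_left (erase_subset j I))]
  congr 1
  ext l
  simp only [mem_erase, mem_univ, mem_union, mem_compl]
  by_cases h : l = j <;> by_cases h' : l ∈ I <;> simp_all

theorem prod_erase_univ_A' {I : Finset (Fin N)} {i j : Fin N} (hj : j ∈ I) :
    ∏ l ∈ (univ.erase i).erase j, A j l =
      (∏ l ∈ (I.erase i).erase j, A j l) * ∏ b ∈ Iᶜ.erase i, A j b := by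
  rw [← prod_union]
  · congr 1
    ext l
    simp only [mem_erase, mem_univ, mem_union, mem_compl]
    by_cases h : l = j <;> by_cases h' : l ∈ I <;> simp_all
  · exact disjoint_compl_right.mono ((erase_subset _ _).trans (erase_subset _ _))
      (erase_subset i Iᶜ)

/-- The coefficient of `∏_{i ∈ I} γ_i` in `u 𝒰 h(u) = D_N(ut) - D_N(u)`, without the common power of
`t`. -/
theorem sum_uCoeff (I : Finset (Fin N)) :
    ∑ j ∈ I, (tau - 1) * (∏ l ∈ univ.erase j, A j l) * prodA (I.erase j) Iᶜ =
      (tau ^ #I - 1) * prodA I Iᶜ := by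
  rw [← sum_prod_A, mul_sum, sum_mul]
  refine sum_congr rfl fun j hj => ?_
  rw [prod_erase_univ_A hj, prodA_eq_mul_erase hj]
  ring

/-- The coefficient of `∏_{i ∈ I} γ_i` in row `i` of `(1 + u 𝒵) h(u) = D_N(u) ℰ`, without the common
power of `t`. -/
theorem sum_zCoeff (I : Finset (Fin N)) (i : Fin N) :
    (if i ∈ I then 0 else tau ^ #I * prodA I (Iᶜ.erase i)) +
      ∑ j ∈ I, zCoeff i j * prodA (I.erase j) Iᶜ = prodA I Iᶜ := by
  split_ifs with hi
  · have hi' : i ∉ I.erase i := notMem_erase i I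
    have hc : Iᶜ.erase i = Iᶜ := erase_eq_of_notMem (by simpa using hi)
    rw [zero_add, ← add_sum_erase I _ hi]
    have h := congrArg (· * prodA I Iᶜ) (prod_A_add_sum_B (I.erase i) i hi')
    simp only [one_mul, add_mul, sum_mul] at h
    rw [← h]
    congr 1
    · rw [zCoeff, if_pos rfl, prod_erase_univ_A hi, mul_assoc, ← prodA_eq_mul_erase hi]
    · refine sum_congr rfl fun j hj => ?_
      rw [mem_erase] at hj
      rw [zCoeff, if_neg hj.1.symm, prod_erase_univ_A' hj.2, hc, prodA_eq_mul_erase hj.2]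
      ring
  · have hi' : i ∈ Iᶜ := by simpa using hi
    rw [prodA_eq_mul_erase_right hi', ← pow_add_sum_B I i hi, add_mul, sum_mul]
    congr 1
    refine sum_congr rfl fun j hj => ?_
    have hij : i ≠ j := fun h => hi (h ▸ hj)
    rw [zCoeff, if_neg hij, prod_erase_univ_A' hj, erase_eq_of_notMem hi,
      prodA_eq_mul_erase_right hi', prodA_eq_mul_erase hj]
    ring

/-- The multiplication by `g` composed with the shift of the variables in `I`. -/
def mulShift (g : RatFun N) (I : Finset (Fin N)) : Op N := mulOp g * (shifts I).toLinearMap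

theorem mulShift_add (f g : RatFun N) (I : Finset (Fin N)) :
    mulShift (f + g) I = mulShift f I + mulShift g I := by
  rw [mulShift, mulOp_add, add_mul]; rfl

theorem mulShift_sum {ι : Type*} (s : Finset ι) (f : ι → RatFun N) (I : Finset (Fin N)) :
    mulShift (∑ i ∈ s, f i) I = ∑ i ∈ s, mulShift (f i) I := by
  rw [mulShift, mulOp_sum, sum_mul]; rfl

theorem mulOp_mul_mulShift (f g : RatFun N) (I : Finset (Fin N)) :
    mulOp f * mulShift g I = mulShift (f * g) I := by
  rw [mulShift, mulShift, mulOp_mul, mul_assoc]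

/-- Multiplying by `f γ_j` on the left enlarges the set of shifted variables, provided that `x_j` does
not occur in `g`. -/
theorem mulOp_mul_gam_mul_mulShift {f g : RatFun N} {j : Fin N} {I : Finset (Fin N)}
    (hj : j ∉ I) (hg : shift j g = g) :
    mulOp f * gam j * mulShift g I = mulShift (f * g) (insert j I) := by
  rw [mulShift, mulShift, shifts_insert hj, toLinearMap_mul', mulOp_mul, gam_eq,
    mul_assoc (mulOp f), ← mul_assoc _ (mulOp g), toLinearMap_mul_mulOp, hg]
  simp only [mul_assoc]

/-- The coefficient of `u ^ n` in `D_N(u)`. -/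
def dCoeff (N n : ℕ) : Op N :=
  ∑ I ∈ powersetCard n univ, mulShift (tau ^ n.choose 2 * prodA I Iᶜ) I

/-- The coefficient of `u ^ n` in the operator `D_{N-1}(ut)` in the variables other than `x_i`,
which acts on functions of all the variables. -/
def hCoeff (n : ℕ) (i : Fin N) : Op N :=
  ∑ I ∈ powersetCard n (univ.erase i),
    mulShift (tau ^ (n + n.choose 2) * prodA I (Iᶜ.erase i)) I

theorem mulShift_one_empty : mulShift (1 : RatFun N) ∅ = 1 := by
  rw [mulShift, shifts_empty, mulOp_one, one_mul]; rfl

theorem dCoeff_zero : dCoeff N 0 = 1 := by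
  simp [dCoeff, prodA, mulShift_one_empty]

theorem hCoeff_zero (i : Fin N) : hCoeff 0 i = 1 := by
  simp [hCoeff, prodA, mulShift_one_empty]

theorem sum_mul_hCoeff (n : ℕ) (g : Fin N → RatFun N) :
    ∑ j, mulOp (g j) * gam j * hCoeff n j =
      ∑ I ∈ powersetCard (n + 1) univ, mulShift
        (tau ^ (n + 1).choose 2 * ∑ j ∈ I, g j * prodA (I.erase j) Iᶜ) I := by
  have h1 : ∀ j, mulOp (g j) * gam j * hCoeff n j =
      ∑ I ∈ powersetCard n (univ.erase j), mulShift
        (g j * (tau ^ (n + n.choose 2) * prodA I (Iᶜ.erase j))) (insert j I) := by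
    intro j
    rw [hCoeff, mul_sum]
    refine sum_congr rfl fun I hI => ?_
    rw [mem_powersetCard, subset_erase] at hI
    refine mulOp_mul_gam_mul_mulShift hI.1.2 ?_
    rw [map_mul, map_pow, map_tau, shift_prodA hI.1.2 (notMem_erase _ _)]
  rw [sum_congr rfl fun j _ => h1 j, sum_powersetCard_erase]
  refine sum_congr rfl fun I _ => ?_
  rw [mul_sum, mulShift_sum]
  refine sum_congr rfl fun j hj => ?_
  rw [insert_erase hj, compl_erase, erase_insert (by simpa using hj), Nat.choose_succ_succ' n 1,
    Nat.choose_one_right]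
  congr 1
  ring

/-- The coefficients of `(1 + u 𝒵) h(u) = D_N(u) ℰ`. -/
theorem hCoeff_succ_add (n : ℕ) (i : Fin N) :
    hCoeff (n + 1) i + ∑ j, Z N i j * hCoeff n j = dCoeff N (n + 1) := by
  have h1 : hCoeff (n + 1) i = ∑ I ∈ powersetCard (n + 1) univ, mulShift
      (tau ^ (n + 1).choose 2 *
        if i ∈ I then 0 else tau ^ #I * prodA I (Iᶜ.erase i)) I := by
    have hs : powersetCard (n + 1) (univ.erase i) =
        (powersetCard (n + 1) univ).filter (i ∉ ·) := by
      ext I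
      simp [mem_powersetCard, subset_erase, and_comm]
    rw [hCoeff, hs, sum_filter]
    refine sum_congr rfl fun I hI => ?_
    by_cases hi : i ∈ I
    · rw [if_neg (not_not.2 hi), if_pos hi, mul_zero, mulShift]
      exact LinearMap.ext fun z => (zero_mul _).symm
    · rw [if_pos hi, if_neg hi, (mem_powersetCard.1 hI).2]
      congr 1
      ring
  simp only [Z_apply]
  rw [sum_mul_hCoeff, h1, ← sum_add_distrib, dCoeff]
  refine sum_congr rfl fun I _ => ?_
  rw [← mulShift_add, ← mul_add, sum_zCoeff]

theorem U_eq (i : Fin N) :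
    U i = mulOp ((tau - 1) * ∏ l ∈ univ.erase i, A i l) * gam i := by
  rw [U, smul_eq_mulOp, mulOp_mul, mul_assoc, map_sub, map_one]
  rfl

/-- The coefficients of `u 𝒰 h(u) = D_N(ut) - D_N(u)`. -/
theorem sum_U_mul_hCoeff (n : ℕ) :
    ∑ i, U i * hCoeff n i = t ^ (n + 1) • dCoeff N (n + 1) - dCoeff N (n + 1) := by
  have ht : t ^ (n + 1) • dCoeff N (n + 1) = mulOp (tau ^ (n + 1)) * dCoeff N (n + 1) := by
    rw [smul_eq_mulOp, map_pow]
    rfl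
  simp only [U_eq]
  rw [sum_mul_hCoeff, ht, dCoeff, mul_sum, eq_sub_iff_add_eq, ← sum_add_distrib]
  refine sum_congr rfl fun I hI => ?_
  rw [sum_uCoeff, mulOp_mul_mulShift, ← mulShift_add, (mem_powersetCard.1 hI).2]
  congr 1
  ring

/-- The coefficients of `u 𝒰 (1 + u 𝒵)⁻¹ ℰ D_N(u) = D_N(ut) - D_N(u)`. -/
theorem sum_resolvent_mul_dCoeff (n : ℕ) :
    ∑ p ∈ antidiagonal n, PowerSeries.coeff p.1 (resolvent N) * dCoeff N p.2 =
      t ^ (n + 1) • dCoeff N (n + 1) - dCoeff N (n + 1) := by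
  have h := sum_inv_mulVec_eq (Z N) hCoeff (dCoeff N)
    (fun i => by rw [hCoeff_zero, dCoeff_zero]) hCoeff_succ_add n
  rw [← sum_U_mul_hCoeff, ← h]
  simp only [Finset.sum_apply, mul_sum]
  rw [sum_comm]
  refine sum_congr rfl fun p _ => ?_
  rw [resolvent, PowerSeries.coeff_mk, Matrix.mul_assoc, Matrix.mul_apply, sum_mul]
  refine sum_congr rfl fun i _ => ?_
  rw [mul_assoc, Matrix.mul_apply, Matrix.mulVec, dotProduct, sum_mul]
  simp only [rowU, colE, Matrix.of_apply, mul_one]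

/-! ### The expansion of the determinant -/

/-- A product of the operators `p_i γ_i` for `i ∈ I` and `r_i` for `i ∉ I` is brought to normal form:
since `γ_i` fixes `p_j` and `r_j` for `j ≠ i`, all shifts move to the right. -/
theorem prod_map_piecewise (I : Finset (Fin N)) (p r : Fin N → RatFun N)
    (hp : ∀ i j, i ≠ j → shift i (p j) = p j) (hr : ∀ i j, i ≠ j → shift i (r j) = r j)
    (l : List (Fin N)) (hl : l.Nodup) :
    (l.map (I.piecewise (fun i => PowerSeries.X * PowerSeries.C (mulOp (p i) * gam i))
        fun i => PowerSeries.C (mulOp (r i)))).prod =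
      PowerSeries.X ^ #(I ∩ l.toFinset) *
        PowerSeries.C (mulShift (l.map (I.piecewise p r)).prod (I ∩ l.toFinset)) := by
  induction l with
  | nil => simp [mulShift_one_empty]
  | cons i l ih =>
    rw [List.nodup_cons] at hl
    have hi : i ∉ I ∩ l.toFinset := by simp [hl.1]
    rw [List.map_cons, List.prod_cons, ih hl.2, List.map_cons, List.prod_cons, List.toFinset_cons]
    by_cases h : i ∈ I
    · have hs : shift i (l.map (I.piecewise p r)).prod = (l.map (I.piecewise p r)).prod := by
        rw [map_list_prod, List.map_map]
        congr 1
        refine List.map_congr_left fun j hj => ?_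
        have hij : i ≠ j := fun e => hl.1 (e ▸ hj)
        by_cases hj' : j ∈ I
        · simp [hj', hp i j hij]
        · simp [hj', hr i j hij]
      rw [inter_insert_of_mem h, card_insert_of_notMem hi, piecewise_eq_of_mem _ _ _ h,
        piecewise_eq_of_mem _ _ _ h, ← mulOp_mul_gam_mul_mulShift hi hs, pow_succ',
        map_mul PowerSeries.C (mulOp (p i) * gam i),
        mul_assoc PowerSeries.X, ← mul_assoc (PowerSeries.C _),
        (PowerSeries.commute_X_pow (PowerSeries.C (mulOp (p i) * gam i)) _).eq]
      simp only [mul_assoc]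
    · rw [inter_insert_of_notMem h, piecewise_eq_of_notMem _ _ _ h,
        piecewise_eq_of_notMem _ _ _ h, ← mulOp_mul_mulShift, map_mul, ← mul_assoc,
        (PowerSeries.commute_X_pow (PowerSeries.C (mulOp (r i))) _).eq, mul_assoc]

/-- The determinant `det [x_i^{N-j} v_i^{j-1}]`, where `v_i = t` for `i ∈ I` and `v_i = 1`
otherwise. -/
def detPol (I : Finset (Fin N)) : Pol N :=
  (Matrix.projVandermonde (fun i => if i ∈ I then MvPolynomial.C t else 1) MvPolynomial.X).det

theorem algebraMap_detPol (I : Finset (Fin N)) :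
    algebraMap (Pol N) (RatFun N) (detPol I) =
      (Matrix.projVandermonde (fun i => if i ∈ I then tau else 1) x).det := by
  rw [detPol, RingHom.map_det, ← Matrix.projVandermonde_map]
  congr 2
  funext i
  rw [apply_ite (algebraMap (Pol N) (RatFun N)), map_one]
  rfl

/-- The expansion of the determinant: the summands with the shifts `γ_i`, `i ∈ I`, add up to the
Vandermonde determinant in which `x_i^{N-j}` is multiplied by `t^{j-1}` for `i ∈ I`. -/
theorem coeff_D (n : ℕ) :
    PowerSeries.coeff n (D N) = ∑ I ∈ powersetCard n univ,
      mulShift ((vand N)⁻¹ * algebraMap (Pol N) (RatFun N) (detPol I)) I := by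
  have hfac : ∀ σ : Equiv.Perm (Fin N),
      (List.ofFn fun i : Fin N =>
        PowerSeries.C (mulOp (x i ^ (N - 1 - (σ i : ℕ)))) *
          (1 + PowerSeries.X * PowerSeries.C (t ^ (σ i : ℕ) • gam i))).prod =
      ∑ I : Finset (Fin N), PowerSeries.X ^ #I * PowerSeries.C (mulShift (∏ i,
        Matrix.projVandermonde (fun i => if i ∈ I then tau else 1) x i (σ i)) I) := by
    intro σ
    have he : (fun i : Fin N =>
        PowerSeries.C (mulOp (x i ^ (N - 1 - (σ i : ℕ)))) *
          (1 + PowerSeries.X * PowerSeries.C (t ^ (σ i : ℕ) • gam i))) =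
        (fun i => PowerSeries.X * PowerSeries.C
          (mulOp (tau ^ (σ i : ℕ) * x i ^ ((σ i).rev : ℕ)) * gam i)) +
        fun i => PowerSeries.C (mulOp (x i ^ ((σ i).rev : ℕ))) := by
      funext i
      have hrev : N - 1 - (σ i : ℕ) = ((σ i).rev : ℕ) := by
        rw [Fin.val_rev]
        omega
      rw [Pi.add_apply, hrev, mul_add, mul_one, add_comm, ← mul_assoc,
        (PowerSeries.commute_X (PowerSeries.C (mulOp (x i ^ ((σ i).rev : ℕ))))).eq, mul_assoc,
        ← map_mul, smul_eq_mulOp, ← mul_assoc, ← mulOp_mul, map_pow, mul_comm (x i ^ _)]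
      rfl
    -- Expand the noncommutative product of sums over the sets `I` of factors that contribute `γ_i`.
    rw [← MultilinearMap.mkPiAlgebraFin_apply (R := ℕ), he, MultilinearMap.map_add_univ]
    refine sum_congr rfl fun I _ => ?_
    rw [MultilinearMap.mkPiAlgebraFin_apply, List.ofFn_eq_map, prod_map_piecewise]
    · rw [List.toFinset_finRange, inter_univ, ← List.ofFn_eq_map, List.prod_ofFn]
      congr 4
      funext i
      rw [Matrix.projVandermonde_apply]
      by_cases hi : i ∈ I <;> simp [hi]
    · intro i j hij
      rw [map_mul, map_pow, map_pow, map_tau, shift_x_of_ne hij.symm]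
    · intro i j hij
      rw [map_pow, shift_x_of_ne hij.symm]
    · exact List.nodup_finRange N
  have hcoeff : ∀ (k : ℕ) (P : Op N),
      PowerSeries.coeff n (PowerSeries.X ^ k * PowerSeries.C P) = if k = n then P else 0 := by
    intro k P
    rw [PowerSeries.coeff_X_pow_mul', PowerSeries.coeff_C]
    split_ifs <;> first | rfl | omega
  rw [D, PowerSeries.coeff_C_mul]
  simp only [hfac, map_sum, map_zsmul, hcoeff, smul_sum]
  rw [sum_comm, mul_sum, ← univ_filter_card_eq, sum_filter]
  refine sum_congr rfl fun I _ => ?_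
  split_ifs with hI
  · rw [algebraMap_detPol, ← mulOp_mul_mulShift, ← Matrix.det_transpose, Matrix.det_apply',
      mulShift_sum]
    congr 1
    refine sum_congr rfl fun σ _ => ?_
    rw [← mulOp_mul_mulShift, zsmul_eq_mul]
    congr 1
    refine LinearMap.ext fun z => ?_
    simp [mulOp]
  · simp

theorem vand_ne_zero : vand N ≠ 0 :=
  prod_ne_zero_iff.2 fun _ _ => prod_ne_zero_iff.2 fun _ hj =>
    x_sub_ne_zero (mem_Ioi.1 hj).ne

theorem vand_inv_mul_detPol (I : Finset (Fin N)) :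
    (vand N)⁻¹ * algebraMap (Pol N) (RatFun N) (detPol I) =
      tau ^ (#I).choose 2 * prodA I Iᶜ := by
  set v : Fin N → RatFun N := fun i => if i ∈ I then tau else 1 with hv
  have hpos : ∀ i ∈ I, v i = tau := fun i hi => if_pos hi
  have hneg : ∀ i ∉ I, v i = 1 := fun i hi => if_neg hi
  have h := prod_pairs_eq (fun i j : Fin N => (v j * x i - v i * x j) / (x i - x j))
    (fun i j => by rw [← neg_div_neg_eq]; congr 1 <;> ring) tau I
    (fun i hi j hj hij => by
      have := x_sub_ne_zero hij
      rw [hpos i hi, hpos j hj, ← mul_sub, mul_div_cancel_right₀ _ this])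
    (fun i hi j hj hij => by
      rw [hneg i hi, hneg j hj, one_mul, one_mul, div_self (x_sub_ne_zero hij)])
  have h2 : ∏ i ∈ I, ∏ j ∈ Iᶜ, (v j * x i - v i * x j) / (x i - x j) = prodA I Iᶜ :=
    prod_congr rfl fun i hi => prod_congr rfl fun j hj => by
      rw [hpos i hi, hneg j (mem_compl.1 hj), one_mul, A_eq]
  rw [h2] at h
  rw [← h, algebraMap_detPol, Matrix.det_projVandermonde, vand]
  simp only [prod_div_distrib]
  rw [div_eq_mul_inv, mul_comm]

theorem coeff_D_eq_dCoeff (n : ℕ) : PowerSeries.coeff n (D N) = dCoeff N n := by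
  rw [coeff_D, dCoeff]
  refine sum_congr rfl fun I hI => ?_
  rw [vand_inv_mul_detPol, (mem_powersetCard.1 hI).2]

/-! ### Preservation of symmetric polynomials -/

/-- Modulo `x_i - x_j`, the substitution `x_i ↦ x_j` is the identity. -/
theorem X_sub_X_dvd_sub {σ R : Type*} [CommRing R] [DecidableEq σ] (i j : σ)
    (p : MvPolynomial σ R) :
    (MvPolynomial.X i - MvPolynomial.X j : MvPolynomial σ R) ∣
      p - MvPolynomial.aeval (fun k => MvPolynomial.X (if k = i then j else k)) p := by
  have h : (Ideal.Quotient.mkₐ R (Ideal.span {MvPolynomial.X i - MvPolynomial.X j})) =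
      (Ideal.Quotient.mkₐ R (Ideal.span {MvPolynomial.X i - MvPolynomial.X j})).comp
        (MvPolynomial.aeval
          fun k => (MvPolynomial.X (if k = i then j else k) : MvPolynomial σ R)) := by
    refine MvPolynomial.algHom_ext fun k => ?_
    rw [AlgHom.comp_apply, MvPolynomial.aeval_X]
    split_ifs with hk
    · subst hk
      exact Ideal.Quotient.eq.2 (Ideal.mem_span_singleton_self _)
    · rfl
  rw [← Ideal.mem_span_singleton]
  exact Ideal.Quotient.eq.1 (DFunLike.congr_fun h p)

theorem X_sub_X_dvd_iff {σ R : Type*} [CommRing R] [DecidableEq σ] {i j : σ}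
    (p : MvPolynomial σ R) :
    (MvPolynomial.X i - MvPolynomial.X j : MvPolynomial σ R) ∣ p ↔
      MvPolynomial.aeval (fun k => (MvPolynomial.X (if k = i then j else k) : MvPolynomial σ R)) p
        = 0 := by
  constructor
  · rintro ⟨r, rfl⟩
    rw [map_mul, map_sub, MvPolynomial.aeval_X, MvPolynomial.aeval_X, if_pos rfl, ite_self,
      sub_self, zero_mul]
  · intro h
    have := X_sub_X_dvd_sub i j p
    rwa [h, sub_zero] at this

theorem X_sub_X_ne_zero {σ R : Type*} [CommRing R] [Nontrivial R] {i j : σ} (h : i ≠ j) :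
    (MvPolynomial.X i - MvPolynomial.X j : MvPolynomial σ R) ≠ 0 :=
  sub_ne_zero.2 (MvPolynomial.X_injective.ne h)

theorem prime_X_sub_X {σ R : Type*} [CommRing R] [IsDomain R] [DecidableEq σ] {i j : σ}
    (h : i ≠ j) : Prime (MvPolynomial.X i - MvPolynomial.X j : MvPolynomial σ R) := by
  refine ⟨X_sub_X_ne_zero h, fun hu => ?_, fun a b hab => ?_⟩
  · have := (X_sub_X_dvd_iff (i := i) (j := j) (1 : MvPolynomial σ R)).1 hu.dvd
    rw [map_one] at this
    exact one_ne_zero this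
  · simp only [X_sub_X_dvd_iff, map_mul, mul_eq_zero] at hab ⊢
    exact hab

theorem isRelPrime_X_sub_X {σ K : Type*} [Field K] [LinearOrder σ] {i j k l : σ}
    (hij : i < j) (hkl : k < l) (h : (i, j) ≠ (k, l)) :
    IsRelPrime (MvPolynomial.X i - MvPolynomial.X j : MvPolynomial σ K)
      (MvPolynomial.X k - MvPolynomial.X l) := by
  rw [(prime_X_sub_X hij.ne).irreducible.isRelPrime_iff_not_dvd, X_sub_X_dvd_iff, map_sub,
    MvPolynomial.aeval_X, MvPolynomial.aeval_X, sub_eq_zero, MvPolynomial.X_injective.eq_iff]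
  split_ifs with h1 h2 h2
  · exact fun _ => hkl.ne (h1.trans h2.symm)
  · exact fun h3 => h (by rw [h1, h3])
  · exact fun h3 => (hkl.trans (h2 ▸ hij)).ne h3
  · exact hkl.ne

/-- An alternating polynomial is divisible by the Vandermonde product: it vanishes for `x_i = x_j`,
so it is divisible by each of the pairwise coprime factors `x_i - x_j`. -/
theorem vandermonde_dvd_of_alternating {σ K : Type*} [Field K] [CharZero K] [LinearOrder σ]
    [Fintype σ] [LocallyFiniteOrderTop σ] (p : MvPolynomial σ K)
    (hp : ∀ i j, i ≠ j → MvPolynomial.rename (Equiv.swap i j) p = -p) :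
    ∏ i, ∏ j ∈ Ioi i, (MvPolynomial.X i - MvPolynomial.X j : MvPolynomial σ K) ∣ p := by
  rw [prod_sigma']
  refine prod_dvd_of_isRelPrime ?_ ?_
  · rintro ⟨i, j⟩ hij ⟨k, l⟩ hkl hne
    simp only [coe_sigma, coe_univ, Set.mem_sigma_iff, Set.mem_univ, true_and, coe_Ioi,
      Set.mem_Ioi] at hij hkl
    refine isRelPrime_X_sub_X hij hkl fun h => hne ?_
    obtain ⟨rfl, rfl⟩ := Prod.mk.inj h
    rfl
  · rintro ⟨i, j⟩ hij
    simp only [mem_sigma, mem_univ, true_and, mem_Ioi] at hij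
    rw [X_sub_X_dvd_iff]
    have h := congrArg (MvPolynomial.aeval
      (fun k => (MvPolynomial.X (if k = i then j else k) : MvPolynomial σ K))) (hp i j hij.ne)
    rw [MvPolynomial.aeval_rename, map_neg] at h
    have hf : (fun k => (MvPolynomial.X (if k = i then j else k) : MvPolynomial σ K)) ∘
        Equiv.swap i j = fun k => MvPolynomial.X (if k = i then j else k) := by
      funext k
      rw [Function.comp_apply]
      by_cases h1 : k = i
      · simp [h1]
      · by_cases h2 : k = j
        · simp [h2]
        · rw [Equiv.swap_apply_of_ne_of_ne h1 h2]
    rw [hf] at h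
    exact self_eq_neg.1 h

/-- The numerator of the coefficient of `u ^ n` in `D_N(u)` applied to a polynomial. -/
def numer (n : ℕ) (p : Pol N) : Pol N :=
  ∑ I ∈ powersetCard n univ, detPol I * scalePol I p

theorem rename_detPol (τ : Equiv.Perm (Fin N)) (I : Finset (Fin N)) :
    MvPolynomial.rename τ (detPol I) =
      ((Equiv.Perm.sign τ : ℤˣ) : ℤ) * detPol (I.map τ.toEmbedding) := by
  rw [detPol, detPol, ← Matrix.det_permute, AlgHom.map_det]
  congr 1
  ext1 i j
  rw [AlgHom.mapMatrix_apply, Matrix.map_apply, Matrix.submatrix_apply,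
    Matrix.projVandermonde_apply, Matrix.projVandermonde_apply, map_mul, map_pow, map_pow,
    MvPolynomial.rename_X]
  by_cases h : i ∈ I <;> simp [h]

theorem rename_scalePol (τ : Equiv.Perm (Fin N)) (I : Finset (Fin N)) (p : Pol N) :
    MvPolynomial.rename τ (scalePol I p) =
      scalePol (I.map τ.toEmbedding) (MvPolynomial.rename τ p) := by
  have h : (MvPolynomial.rename τ).comp (scalePol I) =
      (scalePol (I.map τ.toEmbedding)).comp (MvPolynomial.rename τ) := by
    refine MvPolynomial.algHom_ext fun i => ?_
    rw [AlgHom.comp_apply, AlgHom.comp_apply, MvPolynomial.rename_X, scalePol, scalePol,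
      MvPolynomial.aeval_X, MvPolynomial.aeval_X]
    by_cases h : i ∈ I <;> simp [h]
  exact DFunLike.congr_fun h p

theorem rename_numer (τ : Equiv.Perm (Fin N)) (n : ℕ) (p : Pol N) (hp : p.IsSymmetric) :
    MvPolynomial.rename τ (numer n p) = ((Equiv.Perm.sign τ : ℤˣ) : ℤ) * numer n p := by
  rw [numer, map_sum, mul_sum]
  refine sum_bij (fun I _ => I.map τ.toEmbedding) ?_ ?_ ?_ ?_
  · intro I hI
    simpa [mem_powersetCard] using hI
  · intro I _ J _ h
    exact map_injective _ h
  · intro J hJ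
    refine ⟨J.map τ.symm.toEmbedding, by simpa [mem_powersetCard] using hJ, ?_⟩
    ext i
    simp
  · intro I _
    rw [map_mul, rename_detPol, rename_scalePol, hp τ, mul_assoc]

theorem detPol_empty :
    detPol (∅ : Finset (Fin N)) = ∏ i, ∏ j ∈ Ioi i, (MvPolynomial.X i - MvPolynomial.X j) := by
  simp [detPol, Matrix.det_projVandermonde]

theorem detPol_empty_ne_zero : detPol (∅ : Finset (Fin N)) ≠ 0 := by
  rw [detPol_empty]
  exact prod_ne_zero_iff.2 fun _ _ => prod_ne_zero_iff.2 fun _ hj =>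
    X_sub_X_ne_zero (mem_Ioi.1 hj).ne

theorem exists_numer_eq (n : ℕ) (p : Pol N) (hp : p.IsSymmetric) :
    ∃ r : Pol N, r.IsSymmetric ∧ numer n p = detPol ∅ * r := by
  obtain ⟨r, hr⟩ := vandermonde_dvd_of_alternating (numer n p) fun i j hij => by
    rw [rename_numer _ _ _ hp, Equiv.Perm.sign_swap hij]
    push_cast
    exact neg_one_mul _
  rw [← detPol_empty] at hr
  refine ⟨r, fun τ => ?_, hr⟩
  have h := rename_numer τ n p hp
  rw [hr, map_mul, rename_detPol, map_empty, mul_assoc] at h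
  have hs : (((Equiv.Perm.sign τ : ℤˣ) : ℤ) : Pol N) ≠ 0 := by
    rcases Int.units_eq_one_or (Equiv.Perm.sign τ) with h | h <;> simp [h]
  exact mul_left_cancel₀ detPol_empty_ne_zero (mul_left_cancel₀ hs h)

theorem mem_Lam_iff (f : RatFun N) :
    f ∈ Lam N ↔ ∃ p : Pol N, p.IsSymmetric ∧ algebraMap (Pol N) (RatFun N) p = f :=
  Iff.rfl

theorem algebraMap_detPol_empty :
    algebraMap (Pol N) (RatFun N) (detPol ∅) = vand N := by
  rw [detPol_empty, vand]
  simp only [map_prod, map_sub]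
  rfl

theorem preserves_D : Preserves (D N) := by
  intro n f hf
  obtain ⟨p, hp, rfl⟩ := (mem_Lam_iff f).1 hf
  obtain ⟨r, hr, hn⟩ := exists_numer_eq n p hp
  refine (mem_Lam_iff _).2 ⟨r, hr, ?_⟩
  have h1 : PowerSeries.coeff n (D N) (algebraMap (Pol N) (RatFun N) p) =
      (vand N)⁻¹ * algebraMap (Pol N) (RatFun N) (numer n p) := by
    rw [coeff_D, LinearMap.sum_apply, numer, map_sum, mul_sum]
    refine sum_congr rfl fun I _ => ?_
    rw [map_mul, ← shifts_algebraMap, ← mul_assoc]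
    rfl
  rw [h1, hn, map_mul, algebraMap_detPol_empty, inv_mul_cancel_left₀ vand_ne_zero]

/-- `D_N(ut) = (1 + u 𝒰 (1 + u 𝒵)⁻¹ ℰ) D_N(u)`, as operators on all rational functions. -/
theorem coeff_rescaleBy_D (n : ℕ) :
    t ^ n • PowerSeries.coeff n (D N) =
      PowerSeries.coeff n ((1 + PowerSeries.X * resolvent N) * D N) := by
  rw [add_mul, one_mul, map_add, mul_assoc]
  cases n with
  | zero => simp
  | succ n =>
    rw [PowerSeries.coeff_succ_X_mul, PowerSeries.coeff_mul]
    simp only [coeff_D_eq_dCoeff]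
    rw [sum_resolvent_mul_dCoeff, add_sub_cancel]

theorem coe_coeff_ratio (h : Preserves (D N)) (n : ℕ) (f : Lam N) :
    ((PowerSeries.coeff n (ratio (restr (D N) h)) f : Lam N) : RatFun N) =
      (PowerSeries.coeff n (1 + PowerSeries.X * resolvent N) : Op N) (f : RatFun N) := by
  have hc : PowerSeries.constantCoeff (restr (D N) h) = 1 := by
    rw [← PowerSeries.coeff_zero_eq_constantCoeff_apply, restr, PowerSeries.coeff_mk]
    refine LinearMap.ext fun z => Subtype.ext ?_
    rw [LinearMap.coe_restrict_apply, coeff_D_eq_dCoeff, dCoeff_zero]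
    rfl
  have hP : ∀ (n : ℕ) (w : Lam N), (PowerSeries.coeff n (restr (D N) h) w : RatFun N) =
      PowerSeries.coeff n (D N) (w : RatFun N) := by
    intro n w
    rw [restr, PowerSeries.coeff_mk]
    rfl
  have hP' : ∀ (n : ℕ) (w : Lam N),
      (PowerSeries.coeff n (rescaleBy t (restr (D N) h)) w : RatFun N) =
        (PowerSeries.coeff n ((1 + PowerSeries.X * resolvent N) * D N) : Op N) (w : RatFun N) := by
    intro n w
    rw [← coeff_rescaleBy_D, rescaleBy, PowerSeries.coeff_mk, LinearMap.smul_apply,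
      Submodule.coe_smul, hP]
    rfl
  exact coe_coeff_mul_apply (D N) _ (restr (D N) h) (rescaleBy t (restr (D N) h))
    (seriesInv (restr (D N) h)) hP hP' (mul_seriesInv _ hc) n f

end

end Macdonald

theorem corollary2p6 (N : ℕ) (hN : 1 ≤ N) :
    PowerSeries.constantCoeff (Macdonald.D N) = 1 ∧
    ∃ h : Macdonald.Preserves (Macdonald.D N),
      ∀ (n : ℕ) (f : Macdonald.Lam N),
        ((PowerSeries.coeff n (Macdonald.ratio (Macdonald.restr (Macdonald.D N) h)) f :
            Macdonald.Lam N) : Macdonald.RatFun N) =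
          (PowerSeries.coeff n (1 + PowerSeries.X * Macdonald.resolvent N) : Macdonald.Op N)
            (f : Macdonald.RatFun N) := by
  refine ⟨?_, Macdonald.preserves_D, fun n f => Macdonald.coe_coeff_ratio _ n f⟩
  rw [← PowerSeries.coeff_zero_eq_constantCoeff_apply, Macdonald.coeff_D_eq_dCoeff,
    Macdonald.dCoeff_zero]
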